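/- Let $k \ge 1$ be an integer. A subset $A$ of a group $G$ is called $k$-stable if there are no $a_1,\dots,a_k,b_1,\dots,b_k \in G$ such that, for all $i,j$, one has $a_i b_j \in A$ if and only if $i \le j$. There are constants $C_k > 0$ and $e_k \in \mathbb{N}$, depending only on $k$, such that the following holds. Let $G$ be a finite group, let $A \subseteq G$ be a $k$-stable set, and let $0 < \epsilon \le \tfrac12$. Then there is a subgroup $H \le G$ of index $m = [G:H]$ such that: 1. $m \le \epsilon^{-e_k}$, and moreover $m \le C_k\, \epsilon^{-N_k}$, where $N_k = k^{2^{2^{2k}}}$; 2. there is a set $D \subseteq G$ which is a union of left cosets of $H$ and satisfies $|A \mathbin{\triangle} D| < \epsilon |H|$; 3. for every $g \in G$, either $|gH \cap A| < m^{-1}\epsilon|H|$ or $|gH \setminus A| < m^{-1}\epsilon|H|$. -/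

import Mathlib

open scoped Pointwise symmDiff

/-- A subset `A` of a group `G` is `k`-stable if there are no `a₁, …, a_k, b₁, …, b_k` in `G` such
that, for all `i` and `j`, `a_i b_j ∈ A` if and only if `i ≤ j`. -/
def IsKStable {G : Type*} [Group G] (k : ℕ) (A : Set G) : Prop :=
  ¬ ∃ a b : Fin k → G, ∀ i j : Fin k, a i * b j ∈ A ↔ i ≤ j

/-- `D` is a union of left cosets `gH` of the subgroup `H` (possibly of none). -/
def IsUnionOfLeftCosets {G : Type*} [Group G] (H : Subgroup G) (D : Set G) : Prop :=
  ∃ S : Set G, D = ⋃ g ∈ S, g • (H : Set G)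

/-! The displacement of `x`, the proportion of `G` lying in `A` but moved out of it by right
multiplication by `x`, is symmetric and subadditive. Stability forbids tall trees for `c * x ∈ A`
(`IsKStable.not_hasTree`), and this is used twice.

If displacements occurred at `d` widely separated scales, products of sublists of such elements
would be the leaves of a tree of height `d` (`HasTree.of_lacunary`). So some scale is empty
(`exists_window`), and below the gap the elements form a subgroup `H`. Elements outside `H` have
large displacement, so coset representatives are pairwise separated; a large separated family also
gives a tall tree, which bounds the index.

Elements of `H` barely move `A`, so counting pairs inside a coset shows that it is almost contained
in `A` or almost disjoint from it. The scales decrease fast enough for this error to beat the square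
of the index. -/

/-- `HasTree E h X C` says that there is a complete binary tree of height `h` whose inner nodes are
labelled by elements of `C`, whose leaves are labelled by elements of `X`, and such that at each
inner node `c` the leaves `x` below it branch according to the truth value of `E x c`. -/
def HasTree {α β : Type*} (E : α → β → Prop) : ℕ → Set α → Set β → Prop
  | 0, X, _ => X.Nonempty
  | h + 1, X, C => ∃ c ∈ C, HasTree E h (X ∩ {x | E x c}) C ∧ HasTree E h (X ∩ {x | ¬ E x c}) C

/-! ### Binary trees, ladders and separated families -/

namespace HasTree

variable {α β : Type*} {E : α → β → Prop}

lemma mono {h : ℕ} {X Y : Set α} {C : Set β} (hXY : X ⊆ Y) (hX : HasTree E h X C) :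
    HasTree E h Y C := by
  induction h generalizing X Y with
  | zero => exact Set.Nonempty.mono hXY hX
  | succ h ih =>
    obtain ⟨c, hc, h1, h0⟩ := hX
    exact ⟨c, hc, ih (Set.inter_subset_inter_left _ hXY) h1,
      ih (Set.inter_subset_inter_left _ hXY) h0⟩

lemma pred {h : ℕ} {X : Set α} {C : Set β} (hX : HasTree E (h + 1) X C) : HasTree E h X C := by
  obtain ⟨c, -, h1, -⟩ := hX
  exact h1.mono Set.inter_subset_left

lemma of_le {m n : ℕ} (hmn : m ≤ n) {X : Set α} {C : Set β} (hX : HasTree E n X C) :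
    HasTree E m X C := by
  induction hmn with
  | refl => exact hX
  | step _ ih => exact ih hX.pred

lemma nonempty {h : ℕ} {X : Set α} {C : Set β} (hX : HasTree E h X C) : X.Nonempty :=
  hX.of_le (Nat.zero_le h)

/-- If the inner nodes of a tree are coloured with two colours, then one of the colours contains a
large subtree. -/
lemma split {m n : ℕ} {X : Set α} {C C₁ C₂ : Set β} (hC : C ⊆ C₁ ∪ C₂)
    (hX : HasTree E (m + n) X C) : HasTree E m X C₁ ∨ HasTree E n X C₂ := by
  induction hs : m + n generalizing m n X with
  | zero =>
    obtain ⟨rfl, rfl⟩ : m = 0 ∧ n = 0 := by omega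
    exact Or.inl hX.nonempty
  | succ s ih =>
    rw [hs] at hX
    obtain ⟨c, hc, h1, h0⟩ := hX
    rcases hC hc with hc1 | hc2
    · cases m with
      | zero => exact Or.inl (h1.nonempty.mono Set.inter_subset_left)
      | succ m =>
        have e : m + n = s := by omega
        rcases ih (m := m) (n := n) (e ▸ h1) e with h1 | h1
        · rcases ih (m := m) (n := n) (e ▸ h0) e with h0 | h0
          · exact Or.inl ⟨c, hc1, h1, h0⟩
          · exact Or.inr (h0.mono Set.inter_subset_left)
        · exact Or.inr (h1.mono Set.inter_subset_left)
    · cases n with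
      | zero => exact Or.inr (h1.nonempty.mono Set.inter_subset_left)
      | succ n =>
        have e : m + n = s := by omega
        rcases ih (m := m) (n := n) (e ▸ h1) e with h1 | h1
        · exact Or.inl (h1.mono Set.inter_subset_left)
        · rcases ih (m := m) (n := n) (e ▸ h0) e with h0 | h0
          · exact Or.inl (h0.mono Set.inter_subset_left)
          · exact Or.inr ⟨c, hc2, h1, h0⟩

/-- A tall tree contains a long ladder, whose diagonal is not controlled. -/
lemma exists_ladder [Nonempty β] {n : ℕ} {X : Set α} {C : Set β} (hX : HasTree E (2 ^ (n + 1) - 2) X C) :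
    ∃ (l : ℕ → α) (c : ℕ → β), (∀ i < n, l i ∈ X) ∧ (∀ j < n, c j ∈ C) ∧
      ∀ i < n, ∀ j < n, i ≠ j → (E (l i) (c j) ↔ i < j) := by
  induction n generalizing X C with
  | zero =>
    obtain ⟨x, -⟩ := hX.nonempty
    exact ⟨fun _ ↦ x, fun _ ↦ Classical.arbitrary β, by simp, by simp, by simp⟩
  | succ n ih =>
    have hp : 2 ≤ 2 ^ (n + 1) := by
      have := Nat.one_le_two_pow (n := n)
      omega
    obtain ⟨x, hx⟩ := hX.nonempty
    have hX' : HasTree E ((2 ^ (n + 1) - 2 + 1) + (2 ^ (n + 1) - 2 + 1)) X C :=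
      hX.of_le (by rw [pow_succ 2 (n + 1)]; omega)
    have hC : C ⊆ (C ∩ {c | E x c}) ∪ (C ∩ {c | ¬ E x c}) := fun c hc ↦ by
      by_cases hxc : E x c
      · exact Or.inl ⟨hc, hxc⟩
      · exact Or.inr ⟨hc, hxc⟩
    -- Colour each node by its truth value at the leaf `x`. The root `c` of a monochromatic subtree
    -- joins `x` at the front of the ladder (colour true) or at its back (colour false), and the
    -- rest lies on the opposite side of `c`.
    rcases hX'.split hC with ⟨c, hc, -, h⟩ | ⟨c, hc, h, -⟩
    · obtain ⟨l, b, hl, hb, hlb⟩ := ih h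
      refine ⟨fun i ↦ i.casesOn x l, fun j ↦ j.casesOn c b, ?_, ?_, ?_⟩
      · rintro (_ | i) hi
        · exact hx
        · exact (hl i (by omega)).1
      · rintro (_ | j) hj
        · exact hc.1
        · exact (hb j (by omega)).1
      · rintro (_ | i) hi (_ | j) hj hij
        · exact absurd rfl hij
        · simpa using (hb j (by omega)).2
        · simpa using (hl i (by omega)).2
        · simpa using hlb i (by omega) j (by omega) (by omega)
    · obtain ⟨l, b, hl, hb, hlb⟩ := ih h
      refine ⟨fun i ↦ if i < n then l i else x, fun j ↦ if j < n then b j else c, ?_, ?_, ?_⟩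
      · intro i hi
        dsimp only
        split_ifs with h
        · exact (hl i h).1
        · exact hx
      · intro j hj
        dsimp only
        split_ifs with h
        · exact (hb j h).1
        · exact hc.1
      · intro i hi j hj hij
        dsimp only
        split_ifs with h1 h2 h2
        · exact hlb i h1 j h2 hij
        · have : E (l i) c := (hl i h1).2
          simp only [this, true_iff]
          omega
        · have : ¬ E x (b j) := (hb j h2).2
          simp only [this, false_iff]
          omega
        · omega

/-- Some point splits a separated family into two large parts. -/
lemma exists_balanced_split [Finite β] [Nonempty β] {R : ℝ} {F : Finset α}
    (hF : ∀ x ∈ F, ∀ y ∈ F, x ≠ y → R * Nat.card β ≤ ({c | E x c ∧ ¬ E y c}.ncard : ℝ)) :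
    ∃ (c : β) (F₁ F₀ : Finset α), (F₁ : Set α) = (F : Set α) ∩ {x | E x c} ∧
      (F₀ : Set α) = (F : Set α) ∩ {x | ¬ E x c} ∧ F₁.card + F₀.card = F.card ∧
      R * (F.card * (F.card - 1) : ℝ) ≤ F₁.card * F₀.card := by
  classical
  cases nonempty_fintype β
  suffices ∃ c : β, R * (F.card * (F.card - 1) : ℝ) ≤
      (F.filter fun x ↦ E x c).card * (F.filter fun x ↦ ¬ E x c).card by
    obtain ⟨c, hc⟩ := this
    exact ⟨c, _, _, by ext; simp, by ext; simp, Finset.card_filter_add_card_filter_not _, hc⟩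
  -- Double count triples `(c, x, y)` with `E x c` and `¬ E y c`, then average over `c`.
  have hdc := Finset.sum_card_bipartiteAbove_eq_sum_card_bipartiteBelow
    (s := (Finset.univ : Finset β)) (t := F.offDiag)
    (fun (c : β) (p : α × α) ↦ E p.1 c ∧ ¬ E p.2 c)
  have habove : ∀ c : β, (F.offDiag.bipartiteAbove
      (fun (c : β) (p : α × α) ↦ E p.1 c ∧ ¬ E p.2 c) c).card =
      (F.filter fun x ↦ E x c).card * (F.filter fun x ↦ ¬ E x c).card := by
    intro c
    rw [← Finset.card_product]
    congr 1
    ext ⟨x, y⟩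
    simp only [Finset.mem_bipartiteAbove, Finset.mem_offDiag, Finset.mem_product,
      Finset.mem_filter]
    constructor
    · rintro ⟨⟨hx, hy, -⟩, h1, h0⟩
      exact ⟨⟨hx, h1⟩, hy, h0⟩
    · rintro ⟨⟨hx, h1⟩, hy, h0⟩
      exact ⟨⟨hx, hy, fun h ↦ h0 (h ▸ h1)⟩, h1, h0⟩
  simp only [habove] at hdc
  have hbelow : ∀ p ∈ F.offDiag, R * Nat.card β ≤ (((Finset.univ : Finset β).bipartiteBelow
      (fun (c : β) (p : α × α) ↦ E p.1 c ∧ ¬ E p.2 c) p).card : ℝ) := by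
    rintro ⟨x, y⟩ hp
    rw [Finset.mem_offDiag] at hp
    refine (hF x hp.1 y hp.2.1 hp.2.2).trans_eq ?_
    rw [← Set.ncard_coe_finset]
    congr 2
    ext
    simp
  have hlow := Finset.card_nsmul_le_sum _ _ _ hbelow
  rw [← Nat.cast_sum, ← hdc, Finset.offDiag_card, nsmul_eq_mul,
    Nat.cast_sub (Nat.le_mul_self _)] at hlow
  push_cast at hlow
  by_contra! hcon
  have hup := Finset.sum_lt_sum_of_nonempty (Finset.univ_nonempty (α := β)) fun c _ ↦ hcon c
  rw [Finset.sum_const, Finset.card_univ, nsmul_eq_mul, ← Nat.card_eq_fintype_card] at hup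
  nlinarith

/-- A large separated family of points is the set of leaves of a tall tree. -/
lemma of_separated [Finite β] [Nonempty β] {R : ℝ} (hR : 0 < R) (hR1 : R ≤ 1) {h : ℕ}
    {F : Finset α}
    (hF : ∀ x ∈ F, ∀ y ∈ F, x ≠ y → R * Nat.card β ≤ ({c | E x c ∧ ¬ E y c}.ncard : ℝ))
    (hcard : (4 / R) ^ h ≤ (F.card : ℝ)) : HasTree E h (F : Set α) Set.univ := by
  induction h generalizing F with
  | zero =>
    have : 0 < F.card := by
      rw [pow_zero] at hcard
      exact_mod_cast lt_of_lt_of_le one_pos hcard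
    exact Finset.card_pos.1 this
  | succ h ih =>
    have h4 : 4 ≤ 4 / R := by rw [le_div_iff₀ hR]; linarith
    have hp : 1 ≤ (4 / R) ^ h := one_le_pow₀ (by linarith)
    have hm : (4 : ℝ) ≤ F.card := by
      refine le_trans ?_ hcard
      rw [pow_succ]
      nlinarith
    obtain ⟨c, F₁, F₀, h1, h0, hsum, hc⟩ := exists_balanced_split hF
    have hsub1 : F₁ ⊆ F := by rw [← Finset.coe_subset, h1]; exact Set.inter_subset_left
    have hsub0 : F₀ ⊆ F := by rw [← Finset.coe_subset, h0]; exact Set.inter_subset_left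
    have hsum' : (F₁.card : ℝ) + F₀.card = F.card := by exact_mod_cast hsum
    have hgoal : ∀ u v : ℝ, 0 ≤ u → 0 ≤ v → u + v = F.card →
        R * (F.card * (F.card - 1)) ≤ u * v → (4 / R) ^ h ≤ u := by
      intro u v hu hv huv hR'
      have h1 : u * v ≤ u * F.card := mul_le_mul_of_nonneg_left (by linarith) hu
      have h2 : R * ((F.card : ℝ) - 1) ≤ u := by nlinarith
      have h3 : (4 / R) ^ h * 4 ≤ F.card * R := by
        rw [pow_succ, mul_div_assoc', div_le_iff₀ hR] at hcard
        exact hcard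
      nlinarith
    refine ⟨c, Set.mem_univ c, ?_, ?_⟩
    · rw [← h1]
      exact ih (fun x hx y hy ↦ hF x (hsub1 hx) y (hsub1 hy))
        (hgoal _ _ (Nat.cast_nonneg _) (Nat.cast_nonneg _) hsum' hc)
    · rw [← h0]
      exact ih (fun x hx y hy ↦ hF x (hsub0 hx) y (hsub0 hy))
        (hgoal _ F₁.card (Nat.cast_nonneg _) (Nat.cast_nonneg _) (by linarith) (by linarith))

end HasTree

/-- A ladder of length `2 * k` is read at even positions for leaves and odd ones for nodes, avoiding
its diagonal; reversal turns `<` into the required `i ≤ j`. -/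
lemma IsKStable.not_hasTree {G : Type*} [Group G] {k : ℕ} {A : Set G} (hA : IsKStable k A)
    {h : ℕ} (hh : 2 ^ (2 * k + 1) - 2 ≤ h) (X C : Set G) :
    ¬ HasTree (fun x c : G ↦ c * x ∈ A) h X C := by
  intro hX
  obtain ⟨l, c, -, -, hlc⟩ := (hX.of_le hh).exists_ladder
  refine hA ⟨fun i ↦ c (2 * (Fin.rev i : ℕ) + 1), fun j ↦ l (2 * (Fin.rev j : ℕ)), fun i j ↦ ?_⟩
  rw [hlc _ (by omega) _ (by omega) (by omega), ← Fin.rev_le_rev, Fin.le_def]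
  omega

/-! ### Displacement as a symmetric subadditive function -/

section Displacement

variable {G : Type*} [Group G]

/-- The proportion of elements of `A` in the group `G` that right multiplication by `x` moves out
of `A`. -/
noncomputable def displacement (A : Set G) (x : G) : ℝ :=
  ({g | g ∈ A ∧ g * x ∉ A}.ncard : ℝ) / Nat.card G

lemma ncard_mul_right_mem (p : G → Prop) (x : G) : {g | p (g * x)}.ncard = {g | p g}.ncard := by
  rw [← Set.ncard_image_of_injective _ (mul_left_injective x)]
  congr 1
  ext g
  simp only [Set.mem_image, Set.mem_ofPred_eq]
  exact ⟨fun ⟨h, hh, e⟩ ↦ e ▸ hh, fun h ↦ ⟨g * x⁻¹, by simpa using h, by simp⟩⟩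

variable (A : Set G)

lemma displacement_nonneg (x : G) : 0 ≤ displacement A x := by
  unfold displacement
  positivity

lemma displacement_one : displacement A 1 = 0 := by
  simp [displacement]

variable [Finite G]

lemma ncard_eq_displacement_mul (x : G) :
    ({g | g ∈ A ∧ g * x ∉ A}.ncard : ℝ) = displacement A x * Nat.card G := by
  have : (Nat.card G : ℝ) ≠ 0 := Nat.cast_ne_zero.2 Nat.card_pos.ne'
  rw [displacement, div_mul_cancel₀ _ this]

lemma displacement_inv (x : G) : displacement A x⁻¹ = displacement A x := by
  unfold displacement
  rw [← ncard_mul_right_mem (fun g ↦ g ∈ A ∧ g * x⁻¹ ∉ A) x]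
  simp only [mul_inv_cancel_right]
  congr 2
  have h1 := Set.ncard_inter_add_ncard_sdiff_eq_ncard {g : G | g * x ∈ A} A
  have h2 := Set.ncard_inter_add_ncard_sdiff_eq_ncard A {g : G | g * x ∈ A}
  have h3 : {g : G | g * x ∈ A}.ncard = A.ncard := ncard_mul_right_mem (fun g ↦ g ∈ A) x
  rw [Set.inter_comm] at h1
  change ({g : G | g * x ∈ A} \ A).ncard = (A \ {g : G | g * x ∈ A}).ncard
  omega

lemma displacement_mul_le (x y : G) :
    displacement A (x * y) ≤ displacement A x + displacement A y := by
  unfold displacement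
  rw [← add_div]
  gcongr
  rw [← ncard_mul_right_mem (fun g ↦ g ∈ A ∧ g * y ∉ A) x, ← Nat.cast_add]
  norm_cast
  refine le_trans (Set.ncard_le_ncard ?_) (Set.ncard_union_le _ _)
  intro g hg
  by_cases hx : g * x ∈ A
  · exact Or.inr ⟨hx, by simpa [mul_assoc] using hg.2⟩
  · exact Or.inl ⟨hg.1, hx⟩

/-- If `r`-small displacements are the same as `R`-small ones, where `2 r ≤ R`, then the elements
of small displacement form a subgroup. -/
def smallDisplacement {r R : ℝ} (hr : 2 * r ≤ R) (hR : 0 ≤ R)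
    (hgap : ∀ x, displacement A x ≤ R → displacement A x ≤ r) : Subgroup G where
  carrier := {x | displacement A x ≤ R}
  mul_mem' := fun {x y} hx hy ↦
    (displacement_mul_le A x y).trans (by linarith [hgap x hx, hgap y hy])
  one_mem' := by simpa [displacement_one] using hR
  inv_mem' := fun {x} hx ↦ by
    rw [Set.mem_ofPred_eq, displacement_inv]
    exact hx

end Displacement

/-! ### Lacunary displacements produce trees -/

section Words

variable {G : Type*} [Group G]

open Classical in
/-- The products of the sublists of a list of elements of a group. -/
noncomputable def subwords : List G → Finset G
  | [] => {1}
  | y :: L => subwords L ∪ (subwords L).image (y * ·)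

lemma card_subwords_le (L : List G) : (subwords L).card ≤ 2 ^ L.length := by
  classical
  induction L with
  | nil => simp [subwords]
  | cons y L ih =>
    have h1 := Finset.card_union_le (subwords L) ((subwords L).image (y * ·))
    have h2 := Finset.card_image_le (s := subwords L) (f := (y * ·))
    rw [List.length_cons, pow_succ]
    simp only [subwords]
    omega

/-- The displacements of the members of the list decrease fast: each exceeds `M` times the sum of
the later ones. -/
def Lacunary (A : Set G) (M : ℝ) : List G → Prop
  | [] => True
  | y :: L => Lacunary A M L ∧ M * (L.map (displacement A)).sum < displacement A y

variable (A : Set G) [Finite G]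

lemma displacement_subwords_le (L : List G) :
    ∀ w ∈ subwords L, displacement A w ≤ (L.map (displacement A)).sum := by
  classical
  induction L with
  | nil => simp [subwords, displacement_one]
  | cons y L ih =>
    intro w hw
    simp only [subwords, Finset.mem_union, Finset.mem_image] at hw
    rw [List.map_cons, List.sum_cons]
    rcases hw with hw | ⟨v, hv, rfl⟩
    · linarith [ih w hw, displacement_nonneg A y]
    · linarith [ih v hv, displacement_mul_le A y v]

/-- If `y` has much larger displacement than all elements of `W`, then some `g` lies in `A`
together with all `g * w`, while no `g * y * w` lies in `A`. -/
lemma exists_mem_forall_mul_mem (W : Finset G) {s : ℝ} (hs : ∀ w ∈ W, displacement A w ≤ s) {y : G}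
    (hy : 2 * W.card * s < displacement A y) :
    ∃ g, ∀ w ∈ W, g * w ∈ A ∧ g * (y * w) ∉ A := by
  classical
  cases nonempty_fintype G
  by_contra! hcon
  set B : G → Set G := fun w ↦
    {g | g ∈ A ∧ g * w ∉ A} ∪ {g | g * (y * w) ∈ A ∧ g * (y * w) * w⁻¹ ∉ A} with hB
  -- Union bound: if `g` fails at `w`, then either `w` moves `g` out of `A`, or `w⁻¹` moves `g * (y
  -- * w)` out.
  have hsub : {g | g ∈ A ∧ g * y ∉ A} ⊆ ⋃ w ∈ W, B w := by
    intro g hg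
    obtain ⟨w, hw, h⟩ := hcon g
    refine Set.mem_biUnion hw ?_
    by_cases hgw : g * w ∈ A
    · exact Or.inr ⟨h hgw, by simpa [mul_assoc] using hg.2⟩
    · exact Or.inl ⟨hg.1, hgw⟩
  have hBc : ∀ w ∈ W, ((B w).ncard : ℝ) ≤ 2 * s * Nat.card G := by
    intro w hw
    have h1 : ((B w).ncard : ℝ) ≤ _ := Nat.cast_le.2 (Set.ncard_union_le _ _)
    rw [ncard_mul_right_mem (fun g ↦ g ∈ A ∧ g * w⁻¹ ∉ A) (y * w), Nat.cast_add,
      ncard_eq_displacement_mul, ncard_eq_displacement_mul, displacement_inv] at h1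
    have h2 := mul_le_mul_of_nonneg_right (hs w hw) (Nat.cast_nonneg (α := ℝ) (Nat.card G))
    linarith
  have h1 : (({g | g ∈ A ∧ g * y ∉ A}.ncard : ℕ) : ℝ) ≤ ∑ w ∈ W, ((B w).ncard : ℝ) := by
    rw [← Nat.cast_sum]
    exact Nat.cast_le.2 ((Set.ncard_le_ncard hsub).trans (Finset.set_ncard_biUnion_le W B))
  have h2 := Finset.sum_le_card_nsmul W _ _ hBc
  rw [ncard_eq_displacement_mul] at h1
  rw [nsmul_eq_mul] at h2
  have h3 : (0 : ℝ) < Nat.card G := Nat.cast_pos.2 Nat.card_pos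
  have h4 := mul_lt_mul_of_pos_right hy h3
  linarith

/-- The head `y` dominates all words `w` in the tail, so one root `g * v⁻¹` separates the leaves `v
* w` from the leaves `v * y * w`. -/
lemma HasTree.of_lacunary {d : ℕ} {L : List G} (hLd : L.length ≤ d)
    (hL : Lacunary A (2 * 2 ^ d) L) (v : G) :
    HasTree (fun x c : G ↦ c * x ∈ A) L.length {x | ∃ w ∈ subwords L, x = v * w} Set.univ := by
  classical
  induction L generalizing v with
  | nil => exact ⟨v, 1, by simp [subwords], by simp⟩
  | cons y L ih =>
    have hLd' : L.length ≤ d := by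
      rw [List.length_cons] at hLd
      omega
    have hsum : 0 ≤ (L.map (displacement A)).sum := by
      refine List.sum_nonneg fun a ha ↦ ?_
      obtain ⟨x, -, rfl⟩ := List.mem_map.1 ha
      exact displacement_nonneg A x
    have hcard : ((subwords L).card : ℝ) ≤ 2 ^ d := by
      refine le_trans (Nat.cast_le.2 (card_subwords_le L)) ?_
      push_cast
      exact pow_le_pow_right₀ one_le_two hLd'
    obtain ⟨g, hg⟩ := exists_mem_forall_mul_mem A (subwords L) (displacement_subwords_le A L)
      (y := y) (lt_of_le_of_lt (by gcongr) hL.2)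
    refine ⟨g * v⁻¹, Set.mem_univ _, (ih hLd' hL.1 v).mono ?_, (ih hLd' hL.1 (v * y)).mono ?_⟩
    · rintro _ ⟨w, hw, rfl⟩
      refine ⟨⟨w, Finset.mem_union_left _ hw, rfl⟩, ?_⟩
      simpa [mul_assoc] using (hg w hw).1
    · rintro _ ⟨w, hw, rfl⟩
      refine ⟨⟨y * w, Finset.mem_union_right _ (Finset.mem_image_of_mem _ hw), mul_assoc _ _ _⟩, ?_⟩
      simpa [mul_assoc] using (hg w hw).2

/-- If the displacement function has values in each of the windows `(4 * 2 ^ d * R (i + 1), R i]` for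
`i < d`, then there is a tree of height `d`. -/
lemma exists_window {d : ℕ} (R : ℕ → ℝ) (hRpos : ∀ i, 0 < R i)
    (hR : ∀ i, 2 * R (i + 1) ≤ R i)
    (hno : ¬ HasTree (fun x c : G ↦ c * x ∈ A) d Set.univ Set.univ) :
    ∃ i < d, ∀ x, displacement A x ≤ R i → displacement A x ≤ 4 * 2 ^ d * R (i + 1) := by
  by_contra! hcon
  have key : ∀ n ≤ d, ∃ L : List G, L.length = n ∧ Lacunary A (2 * 2 ^ d) L ∧
      (L.map (displacement A)).sum ≤ 2 * R (d - n) := by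
    intro n
    induction n with
    | zero =>
      intro _
      exact ⟨[], rfl, trivial, by simpa using (hRpos d).le⟩
    | succ n ih =>
      intro hn
      obtain ⟨L, hlen, hL, hsum⟩ := ih (by omega)
      obtain ⟨y, hy1, hy2⟩ := hcon (d - (n + 1)) (by omega)
      have e : d - (n + 1) + 1 = d - n := by omega
      rw [e] at hy2
      have hR' := hR (d - (n + 1))
      rw [e] at hR'
      refine ⟨y :: L, by simp [hlen], ⟨hL, lt_of_le_of_lt ?_ hy2⟩, ?_⟩
      · have := mul_le_mul_of_nonneg_left hsum (show (0 : ℝ) ≤ 2 * 2 ^ d by positivity)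
        linarith
      · rw [List.map_cons, List.sum_cons]
        linarith
  obtain ⟨L, hlen, hL, -⟩ := key d le_rfl
  have := HasTree.of_lacunary A hlen.le hL 1
  rw [hlen] at this
  exact hno (this.mono (Set.subset_univ _))

end Words

/-! ### Index bound and near-homogeneity of cosets -/

section Cosets

variable {G : Type*} [Group G] [Finite G] (A : Set G) (H : Subgroup G)

lemma Subgroup.index_lt_of_displacement {R : ℝ} (hR : 0 < R) (hR1 : R ≤ 1)
    (hH : ∀ x ∉ H, R ≤ displacement A x) {d : ℕ}
    (hno : ¬ HasTree (fun x c : G ↦ c * x ∈ A) d Set.univ Set.univ) :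
    (H.index : ℝ) < (4 / R) ^ d := by
  classical
  cases nonempty_fintype (G ⧸ H)
  by_contra! hcon
  have hF : ((Finset.univ : Finset (G ⧸ H)).image Quotient.out).card = H.index := by
    rw [Finset.card_image_of_injective _ Quotient.out_injective, Subgroup.index,
      Nat.card_eq_fintype_card]
    rfl
  refine hno (HasTree.mono (Set.subset_univ _) (HasTree.of_separated hR hR1 ?_ (hF ▸ hcon)))
  intro x hx y hy hxy
  have hxyH : x⁻¹ * y ∉ H := by
    obtain ⟨p, -, rfl⟩ := Finset.mem_image.1 hx
    obtain ⟨q, -, rfl⟩ := Finset.mem_image.1 hy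
    intro h
    rw [← QuotientGroup.eq, QuotientGroup.out_eq', QuotientGroup.out_eq'] at h
    exact hxy (congrArg _ h)
  have h1 := ncard_eq_displacement_mul A (x⁻¹ * y)
  rw [← ncard_mul_right_mem (fun g ↦ g ∈ A ∧ g * (x⁻¹ * y) ∉ A) x] at h1
  simp only [mul_assoc, mul_inv_cancel_left] at h1
  rw [h1]
  exact mul_le_mul_of_nonneg_right (hH _ hxyH) (Nat.cast_nonneg _)

/-- A pair `u ∈ gH ∩ A`, `v ∈ gH \ A` has `v = u * h` with `h ∈ H` moving `u` out of `A`; each `h`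
accounts for at most `r * |G|` pairs. -/
lemma ncard_inter_mul_ncard_sdiff_le {r : ℝ} (hH : ∀ h ∈ H, displacement A h ≤ r) (g : G) :
    ((g • (H : Set G) ∩ A).ncard : ℝ) * ((g • (H : Set G)) \ A).ncard ≤
      Nat.card H * (r * Nat.card G) := by
  classical
  cases nonempty_fintype G
  set T : G → Set (G × G) := fun h ↦ (fun u ↦ (u, u * h)) '' {u | u ∈ A ∧ u * h ∉ A} with hT
  have hsub : (g • (H : Set G) ∩ A) ×ˢ ((g • (H : Set G)) \ A) ⊆
      ⋃ h ∈ (H : Set G).toFinset, T h := by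
    rintro ⟨u, v⟩ ⟨⟨hu, huA⟩, hv, hvA⟩
    rw [mem_leftCoset_iff] at hu hv
    refine Set.mem_biUnion (x := u⁻¹ * v) ?_ ⟨u, ⟨huA, by simpa using hvA⟩, by simp⟩
    have := H.mul_mem (H.inv_mem hu) hv
    simpa [mul_assoc] using this
  have hTc : ∀ h ∈ (H : Set G).toFinset, ((T h).ncard : ℝ) ≤ r * Nat.card G := by
    intro h hh
    refine (Nat.cast_le.2 (Set.ncard_image_le (Set.toFinite _))).trans ?_
    rw [ncard_eq_displacement_mul]
    exact mul_le_mul_of_nonneg_right (hH h (by simpa using hh)) (Nat.cast_nonneg _)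
  have h1 : (((g • (H : Set G) ∩ A) ×ˢ ((g • (H : Set G)) \ A)).ncard : ℝ) ≤
      ∑ h ∈ (H : Set G).toFinset, ((T h).ncard : ℝ) := by
    rw [← Nat.cast_sum]
    exact Nat.cast_le.2 ((Set.ncard_le_ncard hsub).trans (Finset.set_ncard_biUnion_le _ T))
  have h2 := Finset.sum_le_card_nsmul _ _ _ hTc
  rw [Set.ncard_prod, Nat.cast_mul] at h1
  rw [nsmul_eq_mul, ← Set.ncard_eq_toFinset_card'] at h2
  exact h1.trans h2

lemma ncard_inter_lt_or_ncard_sdiff_lt {r ε : ℝ} (hH : ∀ h ∈ H, displacement A h ≤ r)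
    (hr : 2 * r * (H.index : ℝ) ^ 2 < ε) (hε : 0 < ε) (g : G) :
    ((g • (H : Set G) ∩ A).ncard : ℝ) < ε * (Nat.card H : ℝ) / (H.index : ℝ) ∨
      (((g • (H : Set G)) \ A).ncard : ℝ) < ε * (Nat.card H : ℝ) / (H.index : ℝ) := by
  by_contra! hcon
  obtain ⟨h1, h2⟩ := hcon
  have hprod := ncard_inter_mul_ncard_sdiff_le A H hH g
  have hsum : ((g • (H : Set G) ∩ A).ncard : ℝ) + ((g • (H : Set G)) \ A).ncard = Nat.card H := by
    rw [← Nat.cast_add, Set.ncard_inter_add_ncard_sdiff_eq_ncard, Set.ncard_smul_set]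
    rfl
  have hn : (0 : ℝ) < Nat.card H := Nat.cast_pos.2 Nat.card_pos
  have hm : (0 : ℝ) < H.index := Nat.cast_pos.2 (Nat.pos_of_ne_zero H.index_ne_zero_of_finite)
  rw [← H.card_mul_index, Nat.cast_mul] at hprod
  set a := ((g • (H : Set G) ∩ A).ncard : ℝ)
  set b := (((g • (H : Set G)) \ A).ncard : ℝ)
  set n := (Nat.card H : ℝ)
  set m := (H.index : ℝ)
  set δ := ε * n / m with hδ
  have hδ0 : 0 < δ := by positivity
  -- The larger part has at least `n / 2` elements, the smaller at least `δ`.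
  have hab : δ * n ≤ 2 * (a * b) := by
    rcases le_total a b with hle | hle <;> nlinarith
  have hδm : δ * m = ε * n := div_mul_cancel₀ _ hm.ne'
  have h3 : ε * n * n ≤ 2 * (n * (r * (n * m))) * m := by
    calc ε * n * n = δ * n * m := by rw [← hδm]; ring
      _ ≤ 2 * (n * (r * (n * m))) * m := mul_le_mul_of_nonneg_right (by linarith) hm.le
  have h4 : 2 * r * m ^ 2 * (n * n) < ε * (n * n) := mul_lt_mul_of_pos_right hr (by positivity)
  linarith

/-- If all left cosets of `H` are nearly contained in or nearly disjoint from `A`, then `A` is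
nearly a union of left cosets of `H`. -/
lemma exists_isUnionOfLeftCosets {δ : ℝ}
    (hH : ∀ g : G, ((g • (H : Set G) ∩ A).ncard : ℝ) < δ ∨
      (((g • (H : Set G)) \ A).ncard : ℝ) < δ) :
    ∃ D : Set G, IsUnionOfLeftCosets H D ∧ ((A ∆ D).ncard : ℝ) < H.index * δ := by
  classical
  cases nonempty_fintype (G ⧸ H)
  set S : Set (G ⧸ H) := {q | (((q.out : G) • (H : Set G) \ A).ncard : ℝ) < δ}
  set T : G ⧸ H → Set G := fun q ↦
    if q ∈ S then (q.out : G) • (H : Set G) \ A else (q.out : G) • (H : Set G) ∩ A with hT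
  have hmem : ∀ (x : G) (q : G ⧸ H), x ∈ (q.out : G) • (H : Set G) ↔ q = x := by
    intro x q
    rw [mem_leftCoset_iff, SetLike.mem_coe, ← QuotientGroup.eq, QuotientGroup.out_eq']
  refine ⟨⋃ g ∈ Quotient.out '' S, g • (H : Set G), ⟨_, rfl⟩, ?_⟩
  have hsub : A ∆ (⋃ g ∈ Quotient.out '' S, g • (H : Set G)) ⊆ ⋃ q, T q := by
    intro x hx
    refine Set.mem_iUnion.2 ⟨(x : G ⧸ H), ?_⟩
    have hxD : x ∈ (⋃ g ∈ Quotient.out '' S, g • (H : Set G)) ↔ (x : G ⧸ H) ∈ S := by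
      simp only [Set.mem_iUnion, exists_prop, Set.exists_mem_image]
      exact ⟨fun ⟨q, hq, h⟩ ↦ (hmem x q).1 h ▸ hq, fun h ↦ ⟨(x : G ⧸ H), h, (hmem x _).2 rfl⟩⟩
    rw [Set.mem_symmDiff, hxD] at hx
    simp only [hT]
    split_ifs with h
    · exact ⟨(hmem x _).2 rfl, by tauto⟩
    · exact ⟨(hmem x _).2 rfl, by tauto⟩
  have hTc : ∀ q, ((T q).ncard : ℝ) < δ := by
    intro q
    simp only [hT]
    split_ifs with h
    · exact h
    · exact (hH q.out).resolve_right h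
  have h1 : ((A ∆ (⋃ g ∈ Quotient.out '' S, g • (H : Set G))).ncard : ℝ) ≤
      ∑ q, ((T q).ncard : ℝ) := by
    rw [← Nat.cast_sum]
    exact Nat.cast_le.2 ((Set.ncard_le_ncard hsub).trans (Set.ncard_iUnion_le_of_fintype T))
  have h2 := Finset.sum_lt_sum_of_nonempty (Finset.univ_nonempty (α := G ⧸ H)) fun q _ ↦ hTc q
  rw [Finset.sum_const, Finset.card_univ, nsmul_eq_mul, ← Nat.card_eq_fintype_card] at h2
  exact h1.trans_lt h2

/-- A set without trees of height `d` is nearly homogeneous on the left cosets of a subgroup of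
polynomially bounded index. -/
lemma exists_subgroup_of_not_hasTree {d : ℕ} (hd : d ≠ 0)
    (hno : ¬ HasTree (fun x c : G ↦ c * x ∈ A) d Set.univ Set.univ) {ε : ℝ} (hε : 0 < ε)
    (hε1 : ε ≤ 1) :
    ∃ H : Subgroup G,
      (H.index : ℝ) ≤ 4 ^ d * (8 * 2 ^ d * 4 ^ (2 * d)) ^ ((2 * d + 1) ^ d * d) *
        ε⁻¹ ^ ((2 * d + 1) ^ d * d) ∧
      ∀ g : G, ((g • (H : Set G) ∩ A).ncard : ℝ) < ε * (Nat.card H : ℝ) / (H.index : ℝ) ∨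
        (((g • (H : Set G)) \ A).ncard : ℝ) < ε * (Nat.card H : ℝ) / (H.index : ℝ) := by
  set K : ℝ := 8 * 2 ^ d * 4 ^ (2 * d) with hK
  have h2d : (1 : ℝ) ≤ 2 ^ d := one_le_pow₀ one_le_two
  have h4d : (1 : ℝ) ≤ 4 ^ (2 * d) := one_le_pow₀ (by norm_num)
  have hK1 : 8 * 2 ^ d ≤ K := le_mul_of_one_le_right (by positivity) h4d
  have hK0 : 0 < K := by positivity
  set t : ℝ := ε / K with ht
  have htK : t * K = ε := div_mul_cancel₀ _ hK0.ne'
  have ht0 : 0 < t := by positivity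
  have ht1 : t ≤ 1 := by
    rw [ht, div_le_one hK0]
    linarith
  -- The exponent gives `R (i + 1) = R i ^ (2 * d) * R i`, whose first factor cancels the bound `(4
  -- / R i) ^ (2 * d)` on the squared index; `K` collects the constants left over.
  set R : ℕ → ℝ := fun i ↦ t ^ (2 * d + 1) ^ i with hRdef
  have hR0 : ∀ i, 0 < R i := fun i ↦ by positivity
  have hRt : ∀ i, R i ≤ t := fun i ↦
    pow_le_of_le_one ht0.le ht1 (pow_pos (Nat.succ_pos _) i).ne'
  have hRs : ∀ i, R (i + 1) = R i ^ (2 * d) * R i := fun i ↦ by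
    simp only [hRdef]
    rw [← pow_succ, ← pow_mul, pow_succ (2 * d + 1) i]
  have hgap : ∀ i, 2 * (4 * 2 ^ d * R (i + 1)) ≤ R i := by
    intro i
    have h1 : R i ^ (2 * d) ≤ t :=
      (pow_le_of_le_one (hR0 i).le ((hRt i).trans ht1) (by omega)).trans (hRt i)
    have h2 : 8 * 2 ^ d * R i ^ (2 * d) ≤ 1 := by
      calc 8 * 2 ^ d * R i ^ (2 * d) ≤ K * t := by gcongr
        _ ≤ 1 := by linarith
    rw [hRs]
    nlinarith [hR0 i]
  obtain ⟨i, hid, hi⟩ := exists_window A R hR0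
    (fun i ↦ by nlinarith [hgap i, hR0 (i + 1)]) hno
  set H := smallDisplacement A (hgap i) (hR0 i).le hi
  have hindex : (H.index : ℝ) < (4 / R i) ^ d :=
    H.index_lt_of_displacement A (hR0 i) ((hRt i).trans ht1) (fun x hx ↦ (not_le.1 hx).le) hno
  refine ⟨H, hindex.le.trans ?_, ncard_inter_lt_or_ncard_sdiff_lt A H hi ?_ hε⟩
  · rw [div_eq_mul_inv, mul_pow, mul_assoc, ← mul_pow K]
    have hinv : K * ε⁻¹ = t⁻¹ := by rw [ht, inv_div, div_eq_mul_inv]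
    rw [hinv, pow_mul t⁻¹]
    simp only [hRdef]
    rw [← inv_pow]
    have : 1 ≤ t⁻¹ := (one_le_inv₀ ht0).2 ht1
    gcongr
    omega
  · have h0 : (0 : ℝ) ≤ H.index := Nat.cast_nonneg _
    have h1 : (H.index : ℝ) ^ 2 < (4 / R i) ^ (2 * d) := by
      rw [mul_comm 2 d, pow_mul]
      exact pow_lt_pow_left₀ hindex h0 two_ne_zero
    calc 2 * (4 * 2 ^ d * R (i + 1)) * (H.index : ℝ) ^ 2
        < 2 * (4 * 2 ^ d * R (i + 1)) * (4 / R i) ^ (2 * d) := by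
          have := hR0 (i + 1)
          gcongr
      _ = K * R i := by
          have := (hR0 i).ne'
          rw [hRs, div_pow, hK]
          field_simp
          ring
      _ ≤ ε := by
          rw [← htK, mul_comm t]
          exact mul_le_mul_of_nonneg_left (hRt i) hK0.le

end Cosets

/-! ### Exponent arithmetic and conclusion -/

lemma exponent_le {k : ℕ} (hk : 2 ≤ k) :
    (2 * 2 ^ (2 * k + 1) + 1) ^ 2 ^ (2 * k + 1) * 2 ^ (2 * k + 1) ≤ k ^ 2 ^ 2 ^ (2 * k) := by
  set d := 2 ^ (2 * k + 1) with hd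
  have hd1 : 1 ≤ d := Nat.one_le_two_pow
  have h1 : 2 * k + 3 ≤ 2 ^ (k + 1) := by
    induction k, hk using Nat.le_induction with
    | base => norm_num
    | succ n hn ih =>
      have := ih rfl Nat.one_le_two_pow
      rw [pow_succ]
      omega
  have h2 : 3 * k + 3 ≤ 2 ^ (2 * k) := by
    clear h1
    induction k, hk using Nat.le_induction with
    | base => norm_num
    | succ n hn ih =>
      have := ih rfl Nat.one_le_two_pow
      rw [mul_add 2, mul_one, pow_add]
      omega
  calc (2 * d + 1) ^ d * d ≤ (2 * d + 1) ^ d * (2 * d + 1) :=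
        Nat.mul_le_mul_left _ (by omega)
    _ = (2 * d + 1) ^ (d + 1) := (pow_succ _ _).symm
    _ ≤ (2 ^ (2 * k + 3)) ^ 2 ^ (2 * k + 2) := by
        have h3 : 2 * d + 1 ≤ 2 ^ (2 * k + 3) := by
          simp only [pow_add] at hd ⊢
          omega
        have h4 : d + 1 ≤ 2 ^ (2 * k + 2) := by
          simp only [pow_add] at hd ⊢
          omega
        exact (Nat.pow_le_pow_left h3 _).trans (Nat.pow_le_pow_right (by positivity) h4)
    _ = 2 ^ ((2 * k + 3) * 2 ^ (2 * k + 2)) := by rw [← pow_mul]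
    _ ≤ 2 ^ 2 ^ 2 ^ (2 * k) := by
        refine Nat.pow_le_pow_right two_pos ?_
        calc (2 * k + 3) * 2 ^ (2 * k + 2) ≤ 2 ^ (k + 1) * 2 ^ (2 * k + 2) :=
              Nat.mul_le_mul_right _ h1
          _ = 2 ^ (3 * k + 3) := by rw [← pow_add]; congr 1; omega
          _ ≤ 2 ^ 2 ^ (2 * k) := Nat.pow_le_pow_right two_pos h2
    _ ≤ k ^ 2 ^ 2 ^ (2 * k) := Nat.pow_le_pow_left hk _

lemma IsKStable.eq_empty {G : Type*} [Group G] {k : ℕ} (hk : k ≤ 1) {A : Set G}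
    (hA : IsKStable k A) : A = ∅ := by
  by_contra hne
  obtain ⟨x, hx⟩ := Set.nonempty_iff_ne_empty.2 hne
  refine hA ⟨fun _ ↦ x, fun _ ↦ 1, fun i j ↦ ?_⟩
  simp only [mul_one, hx, true_iff, Fin.le_def]
  omega

theorem theorem1p3 (k : ℕ) :
    ∃ (C : ℝ) (e : ℕ), ∀ (G : Type*) [Group G] [Finite G] (A : Set G), IsKStable k A →
      ∀ ε : ℝ, 0 < ε → ε ≤ 1 / 2 →
        ∃ H : Subgroup G,
          (H.index : ℝ) ≤ ε⁻¹ ^ e ∧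
          (H.index : ℝ) ≤ C * ε⁻¹ ^ (k ^ (2 ^ (2 ^ (2 * k)))) ∧
          (∃ D : Set G, IsUnionOfLeftCosets H D ∧
            ((A ∆ D).ncard : ℝ) < ε * (Nat.card H : ℝ)) ∧
          (∀ g : G,
            (((g • (H : Set G)) ∩ A).ncard : ℝ) < ε * (Nat.card H : ℝ) / (H.index : ℝ) ∨
            (((g • (H : Set G)) \ A).ncard : ℝ) < ε * (Nat.card H : ℝ) / (H.index : ℝ)) := by
  set N : ℕ := k ^ 2 ^ 2 ^ (2 * k) with hN
  rcases Nat.lt_or_ge k 2 with hk | hk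
  · refine ⟨1, 0, fun G _ _ A hA ε hε hε2 ↦ ⟨⊤, ?_, ?_, ⟨∅, ⟨∅, by simp⟩, ?_⟩, fun g ↦ Or.inl ?_⟩⟩
    · simp
    · have : 1 ≤ ε⁻¹ := (one_le_inv₀ hε).2 (by linarith)
      simpa using one_le_pow₀ this
    all_goals
      have : (0 : ℝ) < Nat.card G := Nat.cast_pos.2 Nat.card_pos
      have := mul_pos hε this
      rw [hA.eq_empty (by omega)]
      simpa using this
  · set d : ℕ := 2 ^ (2 * k + 1) with hd
    set C : ℝ := 4 ^ d * (8 * 2 ^ d * 4 ^ (2 * d)) ^ ((2 * d + 1) ^ d * d) with hC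
    have hC0 : 0 ≤ C := by positivity
    obtain ⟨j, hj⟩ := pow_unbounded_of_one_lt C one_lt_two
    -- Since `ε⁻¹ ≥ 2`, the constant `C < 2 ^ j` is absorbed into `ε⁻¹ ^ j`.
    refine ⟨C, j + N, fun G _ _ A hA ε hε hε2 ↦ ?_⟩
    obtain ⟨H, hindex, hH⟩ := exists_subgroup_of_not_hasTree A (d := d)
      (by positivity) (hA.not_hasTree (Nat.sub_le _ _) _ _) hε (by linarith)
    have hinv : 2 ≤ ε⁻¹ := by
      rw [le_inv_comm₀ two_pos hε]
      linarith
    have hbound : (H.index : ℝ) ≤ C * ε⁻¹ ^ N :=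
      hindex.trans (mul_le_mul_of_nonneg_left
        (pow_le_pow_right₀ (by linarith) (exponent_le hk)) hC0)
    refine ⟨H, hbound.trans ?_, hbound, ?_, hH⟩
    · rw [pow_add]
      have : C ≤ ε⁻¹ ^ j := hj.le.trans (pow_le_pow_left₀ zero_le_two hinv j)
      exact mul_le_mul_of_nonneg_right this (by positivity)
    · obtain ⟨D, hD, hAD⟩ := exists_isUnionOfLeftCosets A H hH
      refine ⟨D, hD, hAD.trans_eq (mul_div_cancel₀ _ ?_)⟩
      exact Nat.cast_ne_zero.2 H.index_ne_zero_of_finite
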